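/- For a function $F(x,y)$ given by a nonzero two-variable Laurent polynomial with complex coefficients, let $$\mathrm{m}(F)=\frac1{(2\pi i)^2}\iint_{|x|=|y|=1}\log|F(x,y)|\,\frac{dx}{x}\frac{dy}{y}=\frac1{(2\pi)^2}\int_0^{2\pi}\!\!\int_0^{2\pi}\log|F(e^{i\theta_1},e^{i\theta_2})|\,d\theta_1\,d\theta_2$$ be its (logarithmic) Mahler measure. For real $k$ and $\lambda$ put $$Q_k(X,Y)=Y^2+(X^4+kX^3+2kX^2+kX+1)Y+X^4,$$ $$P_\lambda(x,y)=(x+1)y^2+(x^2-(\lambda+2)x+1)y+x(x+1),$$ $$R_\lambda(x,y)=x+x^{-1}+y+y^{-1}+\lambda .$$ Then, with all the Mahler measures involved being given by absolutely convergent integrals: 1. for every real $\lambda\le-5$, $\ \mathrm{m}\big(Q_{\lambda+4}(X-1,Y)\big)=\mathrm{m}\big(R_\lambda(x,y)\big)$; 2. for every real $\lambda\ge13$, $\ \mathrm{m}\big(Q_{\lambda+4}(X-1,Y)\big)=\tfrac12\Big(\mathrm{m}\big(R_\lambda(x,y)\big)+\mathrm{m}\big(P_\lambda(x,y)\big)\Big)$.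 -/

import Mathlib

namespace LiuQin

/-- The square of angles `(θ₁, θ₂) ∈ (0, 2π] × (0, 2π]` that parametrises the torus
`|x| = |y| = 1` by `x = exp (i θ₁)`, `y = exp (i θ₂)`. -/
def angles : Set (ℝ × ℝ) :=
  Set.Ioc 0 (2 * Real.pi) ×ˢ Set.Ioc 0 (2 * Real.pi)

/-- The function `(θ₁, θ₂) ↦ log |F (exp (i θ₁), exp (i θ₂))|`. -/
noncomputable def logAbsOnTorus (F : ℂ → ℂ → ℂ) (θ : ℝ × ℝ) : ℝ :=
  Real.log ‖F (Complex.exp (θ.1 * Complex.I)) (Complex.exp (θ.2 * Complex.I))‖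

/-- The function `log |F|` is Lebesgue integrable over the torus `|x| = |y| = 1`, so that the
integral that defines the Mahler measure of `F` converges absolutely. -/
def HasMahlerMeasure (F : ℂ → ℂ → ℂ) : Prop :=
  MeasureTheory.IntegrableOn (logAbsOnTorus F) angles MeasureTheory.volume

/-- The logarithmic Mahler measure
`m(F) = (2πi)⁻² ∬_{|x| = |y| = 1} log |F(x, y)| dx/x dy/y` of a two-variable (Laurent) polynomial
(given through its values), with `dx/x = i dθ₁` and `dy/y = i dθ₂`. -/
noncomputable def mahler (F : ℂ → ℂ → ℂ) : ℝ :=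
  ((2 * Real.pi) ^ 2)⁻¹ * ∫ θ in angles, logAbsOnTorus F θ

/-- The hyperelliptic family `Q_k`. -/
def Q (k : ℝ) (X Y : ℂ) : ℂ :=
  Y ^ 2 + (X ^ 4 + k * X ^ 3 + 2 * k * X ^ 2 + k * X + 1) * Y + X ^ 4

/-- The elliptic family `P_λ`. -/
def P (l : ℝ) (x y : ℂ) : ℂ :=
  (x + 1) * y ^ 2 + (x ^ 2 - (l + 2) * x + 1) * y + x * (x + 1)

/-- The elliptic family `R_λ` of Laurent polynomials. -/
noncomputable def R (l : ℝ) (x y : ℂ) : ℂ :=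
  x + x⁻¹ + y + y⁻¹ + l

/-- The shifted hyperelliptic family `Q_{λ+4}(X - 1, Y)`. -/
def shiftedQ (l : ℝ) (X Y : ℂ) : ℂ :=
  Q (l + 4) (X - 1) Y

end LiuQin

/-!
Mahler measures are evaluated with Jensen's formula, one variable at a time, until all of them are
means over `|z| = 1` of explicit functions of `τ = |1 + z|²`. Write `p(A, t)` (`bigRoot A t`) for
the larger root of `y² - A y + t`.

*The elliptic families.* The substitution `x = y w` makes `R` a self-reciprocal quadratic in `y`,
and so is `P` up to a unit, whence `m(R_l)` is the mean of `log p(|l|, τ)` (`mahler_R`) and, for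
`l ≥ 13`, `m(P_l)` is the mean of `log p(l + 4 - τ, τ)` (`mahler_P`).

*The hyperelliptic family.* The shifted `Q` is `Y² + B Y + q²` with `q = (X - 1)²` and
`B = 2 q + X² (X² + l X - l)`. For `l ≤ -5` and for `l ≥ 13` one root has `|Y| ≥ 1` and the other
has `|Y| ≤ 1`, as `two_mul_one_add_sq_le` shows. Hence the mean over `Y` of `log |Y² + B Y + q²|`
equals that of `log |q z² + B z + q|` over `z`
(`circleAverage_log_norm_quadratic_eq`). For `|z| = 1` the latter is
`log |X² (X² + l X - l) + τ (X - 1)²|`, and this quartic in `X` is the product of the two factors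
`X² - s X + s`, where `s² + l s + τ = 0`. Exchanging the integrals and applying Jensen's formula in
`X` gives `log p(-l, τ)` for `l ≤ -5`, which is the first claim. For `l ≥ 13` it gives
`(log r + log p(r + 2, 1)) / 2` with `r = p(l, τ)`.

*The remaining identity.* The second claim is thus reduced to the equality of the means of
`log p(p(l, τ) + 2, 1)` and of `log p(l + 4 - τ, τ)` (`integral_log_bigRoot_eq`). As functions of
`l` the two means differ by a quantity tending to `0` at infinity, and their derivatives are one and
the same complete elliptic integral, as two changes of variables show (`integral_period_eq`).

Integrability of `log |F|` near zeros on the torus comes from `hasMahlerMeasure_of_polynomial`.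
-/

open Real MeasureTheory

namespace LiuQin

/-! ### Mahler measures as iterated circle averages -/

lemma exp_mul_I_eq_circleMap (θ : ℝ) : Complex.exp (θ * Complex.I) = circleMap 0 1 θ := by
  simp [circleMap]

lemma circleAverage_eq_setIntegral (f : ℂ → ℝ) :
    circleAverage f 0 1 =
      (2 * π)⁻¹ * ∫ θ in Set.Ioc 0 (2 * π), f (Complex.exp (θ * Complex.I)) := by
  rw [circleAverage_def, intervalIntegral.integral_of_le two_pi_pos.le, smul_eq_mul]
  simp only [exp_mul_I_eq_circleMap]

lemma mahler_eq_circleAverage {F : ℂ → ℂ → ℂ} (hF : HasMahlerMeasure F) :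
    mahler F = circleAverage (fun x => circleAverage (fun y => log ‖F x y‖) 0 1) 0 1 := by
  rw [mahler, angles]
  have h : IntegrableOn (logAbsOnTorus F) (Set.Ioc 0 (2 * π) ×ˢ Set.Ioc 0 (2 * π))
      (volume.prod volume) := hF
  rw [Measure.volume_eq_prod, setIntegral_prod _ h, circleAverage_eq_setIntegral]
  simp only [circleAverage_eq_setIntegral, integral_const_mul, logAbsOnTorus]
  ring

lemma HasMahlerMeasure.swap {F : ℂ → ℂ → ℂ} (hF : HasMahlerMeasure F) :
    HasMahlerMeasure (fun x y => F y x) := by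
  have h : IntegrableOn (logAbsOnTorus F) (Set.Ioc 0 (2 * π) ×ˢ Set.Ioc 0 (2 * π))
      (volume.prod volume) := hF
  exact h.swap

lemma mahler_swap (F : ℂ → ℂ → ℂ) : mahler (fun x y => F y x) = mahler F := by
  rw [mahler, mahler, angles, Measure.volume_eq_prod]
  congr 1
  exact setIntegral_prod_swap (Set.Ioc 0 (2 * π)) (Set.Ioc 0 (2 * π)) (logAbsOnTorus F)

lemma hasMahlerMeasure_of_ne_zero {F : ℂ → ℂ → ℂ}
    (hF : Continuous fun θ : ℝ × ℝ =>
      F (Complex.exp (θ.1 * Complex.I)) (Complex.exp (θ.2 * Complex.I)))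
    (h0 : ∀ x y, ‖x‖ = 1 → ‖y‖ = 1 → F x y ≠ 0) : HasMahlerMeasure F := by
  have hc : Continuous (logAbsOnTorus F) := by
    refine Continuous.log hF.norm fun θ => ?_
    rw [norm_ne_zero_iff]
    exact h0 _ _ (Complex.norm_exp_ofReal_mul_I _) (Complex.norm_exp_ofReal_mul_I _)
  have : IntegrableOn (logAbsOnTorus F) (Set.Icc 0 (2 * π) ×ˢ Set.Icc 0 (2 * π)) :=
    hc.continuousOn.integrableOn_compact (isCompact_Icc.prod isCompact_Icc)
  exact this.mono_set (Set.prod_mono Set.Ioc_subset_Icc_self Set.Ioc_subset_Icc_self)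

/-- If every slice `F x` is a polynomial whose leading coefficient has absolute value at least `1`,
then `log |F|` is integrable on the torus, zeros of `F` notwithstanding: the negative part of
`log |F x|` is controlled by its positive part, because the mean of `log |F x|` is nonnegative. -/
lemma hasMahlerMeasure_of_polynomial {F : ℂ → ℂ → ℂ}
    (hF : Continuous fun θ : ℝ × ℝ =>
      F (Complex.exp (θ.1 * Complex.I)) (Complex.exp (θ.2 * Complex.I)))
    (p : ℂ → Polynomial ℂ) (hp : ∀ x, ‖x‖ = 1 → 1 ≤ ‖(p x).leadingCoeff‖)
    (hpF : ∀ x y, ‖x‖ = 1 → ‖y‖ = 1 → F x y = (p x).eval y) : HasMahlerMeasure F := by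
  set S := Set.Ioc (0 : ℝ) (2 * π) with hS
  obtain ⟨M, hM⟩ := ((isCompact_Icc (a := (0 : ℝ)) (b := 2 * π)).prod
    (isCompact_Icc (a := (0 : ℝ)) (b := 2 * π))).exists_bound_of_continuousOn hF.continuousOn
  have hM' : ∀ a ∈ S, ∀ b ∈ S, ‖F (Complex.exp (a * Complex.I)) (Complex.exp (b * Complex.I))‖
      ≤ M := fun a ha b hb => hM (a, b) ⟨Set.Ioc_subset_Icc_self ha, Set.Ioc_subset_Icc_self hb⟩
  have hmeas : AEStronglyMeasurable (logAbsOnTorus F)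
      ((volume.restrict S).prod (volume.restrict S)) :=
    (measurable_log.comp hF.norm.measurable).aestronglyMeasurable
  have hslice : ∀ a : ℝ, IntegrableOn (fun b => logAbsOnTorus F (a, b)) S := by
    intro a
    have h := (p (Complex.exp (a * Complex.I))).intervalIntegrable_mahlerMeasure
    rw [intervalIntegrable_iff_integrableOn_Ioc_of_le two_pi_pos.le] at h
    refine h.congr_fun (fun b _ => ?_) measurableSet_Ioc
    simp only [logAbsOnTorus]
    rw [hpF _ _ (Complex.norm_exp_ofReal_mul_I _) (Complex.norm_exp_ofReal_mul_I _),
      exp_mul_I_eq_circleMap b]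
  have hnonneg : ∀ a : ℝ, 0 ≤ ∫ b in S, logAbsOnTorus F (a, b) := by
    intro a
    have h1 : 0 ≤ (p (Complex.exp (a * Complex.I))).logMahlerMeasure := by
      rw [Polynomial.logMahlerMeasure_eq_log_MahlerMeasure]
      exact log_nonneg ((hp _ (Complex.norm_exp_ofReal_mul_I _)).trans
        (Polynomial.leadingCoeff_le_mahlerMeasure _))
    rw [Polynomial.logMahlerMeasure_def, circleAverage_eq_setIntegral] at h1
    have h2 := nonneg_of_mul_nonneg_right h1 (inv_pos.2 two_pi_pos)
    refine h2.trans_eq (setIntegral_congr_fun measurableSet_Ioc fun b _ => ?_)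
    simp only [logAbsOnTorus]
    rw [hpF _ _ (Complex.norm_exp_ofReal_mul_I _) (Complex.norm_exp_ofReal_mul_I _)]
  unfold HasMahlerMeasure angles
  rw [IntegrableOn, Measure.volume_eq_prod, ← Measure.prod_restrict, integrable_prod_iff hmeas]
  refine ⟨Filter.Eventually.of_forall hslice, ?_⟩
  refine Integrable.of_bound hmeas.norm.integral_prod_right' (2 * π * (2 * log⁺ M)) ?_
  refine (ae_restrict_iff' measurableSet_Ioc).2 (Filter.Eventually.of_forall fun a ha => ?_)
  rw [Real.norm_of_nonneg (integral_nonneg fun _ => norm_nonneg _)]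
  calc ∫ b in S, ‖logAbsOnTorus F (a, b)‖
      ≤ ∫ b in S, (2 * log⁺ M - logAbsOnTorus F (a, b)) := by
        refine setIntegral_mono_on (hslice a).norm ?_ measurableSet_Ioc fun b hb => ?_
        · exact (integrable_const _).sub (hslice a)
        · have h1 : logAbsOnTorus F (a, b) ≤ log⁺ M :=
            (le_max_right _ _).trans
              (posLog_le_posLog (norm_nonneg _) (hM' a ha b hb))
          have h2 : 0 ≤ log⁺ M := posLog_nonneg
          rw [Real.norm_eq_abs, abs_le]
          constructor <;> linarith
    _ = 2 * π * (2 * log⁺ M) - ∫ b in S, logAbsOnTorus F (a, b) := by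
        rw [integral_sub (integrable_const _) (hslice a), setIntegral_const]
        simp [hS, two_pi_pos.le]
    _ ≤ 2 * π * (2 * log⁺ M) := sub_le_self _ (hnonneg a)

/-- Circle averages are invariant under rotations. -/
lemma circleAverage_mul_left (f : ℂ → ℝ) {w : ℂ} (hw : ‖w‖ = 1) :
    circleAverage (fun z => f (w * z)) 0 1 = circleAverage f 0 1 := by
  rw [circleAverage_eq_integral_add (f := f) (Complex.arg w), circleAverage_def]
  congr 2
  ext θ
  congr 1
  have h : w = Complex.exp (Complex.arg w * Complex.I) := by
    conv_lhs => rw [← Complex.norm_mul_exp_arg_mul_I w, hw]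
    simp
  rw [← exp_mul_I_eq_circleMap, ← exp_mul_I_eq_circleMap]
  conv_lhs => rw [h, ← Complex.exp_add]
  push_cast
  ring_nf

/-! ### Jensen's formula for quadratic polynomials -/

open Polynomial in
lemma mahlerMeasure_linear (a b : ℂ) : (C a * X + C b).mahlerMeasure = max ‖a‖ ‖b‖ := by
  rcases eq_or_ne a 0 with rfl | ha
  · simp
  · exact mahlerMeasure_C_mul_X_add_C ha b

open Polynomial in
lemma circleAverage_log_norm_linear_mul_linear {a b c d : ℂ} (hab : a ≠ 0 ∨ b ≠ 0)
    (hcd : c ≠ 0 ∨ d ≠ 0) :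
    circleAverage (fun z => log ‖(a * z + b) * (c * z + d)‖) 0 1 =
      log (max ‖a‖ ‖b‖) + log (max ‖c‖ ‖d‖) := by
  have key : ∀ {a b : ℂ}, (a ≠ 0 ∨ b ≠ 0) → max ‖a‖ ‖b‖ ≠ 0 := by
    rintro a b (h | h)
    · exact (lt_max_of_lt_left (norm_pos_iff.2 h)).ne'
    · exact (lt_max_of_lt_right (norm_pos_iff.2 h)).ne'
  rw [← log_mul (key hab) (key hcd), ← mahlerMeasure_linear, ← mahlerMeasure_linear,
    ← mahlerMeasure_mul, ← logMahlerMeasure_eq_log_MahlerMeasure, logMahlerMeasure_def]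
  simp

/-! ### The larger root of a real quadratic -/

/-- The larger root of `y ^ 2 - A * y + t`, when `4 * t ≤ A ^ 2`. -/
noncomputable def bigRoot (A t : ℝ) : ℝ := (A + √(A ^ 2 - 4 * t)) / 2

lemma bigRoot_quadratic {A t : ℝ} (h : 4 * t ≤ A ^ 2) :
    bigRoot A t ^ 2 - A * bigRoot A t + t = 0 := by
  have := sq_sqrt (sub_nonneg.2 h)
  unfold bigRoot
  linear_combination this / 4

lemma half_le_bigRoot (A t : ℝ) : A / 2 ≤ bigRoot A t := by
  have := sqrt_nonneg (A ^ 2 - 4 * t)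
  unfold bigRoot
  linarith

lemma bigRoot_le {A t : ℝ} (hA : 0 ≤ A) (ht : 0 ≤ t) : bigRoot A t ≤ A := by
  have : √(A ^ 2 - 4 * t) ≤ A := sqrt_le_iff.2 ⟨hA, by linarith⟩
  unfold bigRoot
  linarith

lemma sub_one_le_bigRoot {A t : ℝ} (h : 1 + t ≤ A) : A - 1 ≤ bigRoot A t := by
  have : A - 2 ≤ √(A ^ 2 - 4 * t) := le_sqrt_of_sq_le (by linarith)
  unfold bigRoot
  linarith

lemma bigRoot_eq_of_add_mul {u v : ℝ} (h : v ≤ u) : bigRoot (u + v) (u * v) = u := by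
  rw [bigRoot, show (u + v) ^ 2 - 4 * (u * v) = (u - v) ^ 2 by ring, sqrt_sq (sub_nonneg.2 h)]
  ring

lemma hasDerivAt_bigRoot {A t : ℝ} (h : 0 < A ^ 2 - 4 * t) :
    HasDerivAt (fun A => bigRoot A t) (bigRoot A t / √(A ^ 2 - 4 * t)) A := by
  have h1 : HasDerivAt (fun A : ℝ => A ^ 2 - 4 * t) (2 * A) A := by
    simpa using (hasDerivAt_pow 2 A).sub_const (4 * t)
  have h2 := ((hasDerivAt_id A).add (h1.sqrt h.ne')).div_const 2
  refine HasDerivAt.congr_deriv (f := fun A => bigRoot A t) h2 ?_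
  have hs : √(A ^ 2 - 4 * t) ≠ 0 := (sqrt_pos.2 h).ne'
  unfold bigRoot
  field_simp
  ring

lemma hasDerivAt_log_bigRoot {A t : ℝ} (hA : 0 < A) (h : 0 < A ^ 2 - 4 * t) :
    HasDerivAt (fun A => log (bigRoot A t)) (1 / √(A ^ 2 - 4 * t)) A := by
  have hb : 0 < bigRoot A t := lt_of_lt_of_le (by linarith) (half_le_bigRoot A t)
  refine ((hasDerivAt_bigRoot h).log hb.ne').congr_deriv ?_
  have hs : √(A ^ 2 - 4 * t) ≠ 0 := (sqrt_pos.2 h).ne'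
  field_simp

lemma measurable_bigRoot : Measurable fun p : ℝ × ℝ => bigRoot p.1 p.2 := by
  unfold bigRoot
  fun_prop

@[fun_prop]
lemma measurable_bigRoot_comp {α : Type*} [MeasurableSpace α] {f g : α → ℝ} (hf : Measurable f)
    (hg : Measurable g) : Measurable fun a => bigRoot (f a) (g a) :=
  measurable_bigRoot.comp (hf.prodMk hg)

/-! ### An identity between elliptic integrals -/

/-- Change of variables `2 + 2 * cos θ = f y` for an increasing bijection `f` from `[0, ρ]` onto
`[0, 4]`. No integrability of `g` is needed. -/
lemma integral_two_add_two_mul_cos {f f' : ℝ → ℝ} {ρ : ℝ} (hρ : 0 < ρ)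
    (hc : ContinuousOn f (Set.Icc 0 ρ)) (hf : ∀ y ∈ Set.Ioo 0 ρ, HasDerivAt f (f' y) y)
    (hpos : ∀ y ∈ Set.Ioo 0 ρ, 0 < f' y) (h0 : f 0 = 0) (h1 : f ρ = 4) (g : ℝ → ℝ) :
    ∫ θ in 0..π, g (2 + 2 * cos θ) =
      ∫ y in Set.Ioo 0 ρ, f' y / √(f y * (4 - f y)) * g (f y) := by
  have hmono : StrictMonoOn f (Set.Icc 0 ρ) := by
    refine strictMonoOn_of_deriv_pos (convex_Icc 0 ρ) hc fun y hy => ?_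
    rw [interior_Icc] at hy
    rw [(hf y hy).deriv]
    exact hpos y hy
  have hmaps : ∀ y ∈ Set.Ioo 0 ρ, 0 < f y ∧ f y < 4 := by
    intro y hy
    constructor
    · rw [← h0]
      exact hmono ⟨le_rfl, hρ.le⟩ (Set.Ioo_subset_Icc_self hy) hy.1
    · rw [← h1]
      exact hmono (Set.Ioo_subset_Icc_self hy) ⟨hρ.le, le_rfl⟩ hy.2
  set ψ : ℝ → ℝ := fun y => arccos ((f y - 2) / 2) with hψ
  have hcos : ∀ y ∈ Set.Ioo 0 ρ, cos (ψ y) = (f y - 2) / 2 := by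
    intro y hy
    have := hmaps y hy
    exact cos_arccos (by linarith) (by linarith)
  have himage : ψ '' Set.Ioo 0 ρ = Set.Ioo 0 π := by
    ext θ
    constructor
    · rintro ⟨y, hy, rfl⟩
      have := hmaps y hy
      exact ⟨arccos_pos.2 (by linarith), arccos_lt_pi.2 (by linarith)⟩
    · intro hθ
      have hc1 : cos θ < 1 := by
        rw [← cos_zero]
        exact cos_lt_cos_of_nonneg_of_le_pi le_rfl hθ.2.le hθ.1
      have hc2 : -1 < cos θ := by
        rw [← cos_pi]
        exact cos_lt_cos_of_nonneg_of_le_pi hθ.1.le le_rfl hθ.2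
      obtain ⟨y, hy, hy'⟩ := intermediate_value_Ioo hρ.le hc
        (show 2 + 2 * cos θ ∈ Set.Ioo (f 0) (f ρ) by
          rw [h0, h1]; constructor <;> linarith)
      refine ⟨y, hy, ?_⟩
      simp only [hψ, hy']
      rw [show (2 + 2 * cos θ - 2) / 2 = cos θ by ring, arccos_cos hθ.1.le hθ.2.le]
  have hinj : Set.InjOn ψ (Set.Ioo 0 ρ) := by
    intro y hy z hz h
    have h2 := congrArg cos h
    rw [hcos y hy, hcos z hz] at h2
    exact hmono.injOn (Set.Ioo_subset_Icc_self hy) (Set.Ioo_subset_Icc_self hz) (by linarith)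
  have hderiv : ∀ y ∈ Set.Ioo 0 ρ,
      HasDerivWithinAt ψ (-(f' y / √(f y * (4 - f y)))) (Set.Ioo 0 ρ) y := by
    intro y hy
    have hb := hmaps y hy
    have h := (hasDerivAt_arccos (x := (f y - 2) / 2) (by linarith) (by linarith)).comp y
      (((hf y hy).sub_const 2).div_const 2)
    refine HasDerivAt.hasDerivWithinAt ?_
    refine HasDerivAt.congr_deriv (f := ψ) h ?_
    have h4 : 0 < f y * (4 - f y) := mul_pos hb.1 (by linarith)
    rw [show 1 - ((f y - 2) / 2) ^ 2 = f y * (4 - f y) / 2 ^ 2 by ring, sqrt_div h4.le,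
      sqrt_sq (by norm_num)]
    have := (sqrt_pos.2 h4).ne'
    field_simp
  rw [intervalIntegral.integral_of_le pi_pos.le, integral_Ioc_eq_integral_Ioo, ← himage,
    integral_image_eq_integral_abs_deriv_smul measurableSet_Ioo hderiv hinj]
  refine setIntegral_congr_fun measurableSet_Ioo fun y hy => ?_
  simp only [hcos y hy, abs_neg, smul_eq_mul]
  rw [abs_of_nonneg (div_nonneg (hpos y hy).le (sqrt_nonneg _))]
  congr 2
  ring

lemma two_add_two_mul_cos_mem (θ : ℝ) : 0 ≤ 2 + 2 * cos θ ∧ 2 + 2 * cos θ ≤ 4 :=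
  ⟨by linarith [neg_one_le_cos θ], by linarith [cos_le_one θ]⟩

/-- Both sides are the period `∫ dy / √(y (l + 4 - y) (y² - l y + 4))` over `[0, ρ]`, where `ρ` is
the smaller root of `y² - l y + 4`. On the left-hand side the substitution is
`t = y (l + 4 - y) / (1 + y)`, whose inverse is the smaller root of `y² - (l + 4 - t) y + t`; on
the right-hand side it is `t = y (l - y)`, so that `l - y` is the larger root of
`r² - l r + t`. -/
lemma integral_period_eq {l : ℝ} (hl : 5 < l) :
    ∫ θ in 0..π, 1 / √((l + 4 - (2 + 2 * cos θ)) ^ 2 - 4 * (2 + 2 * cos θ)) =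
      ∫ θ in 0..π, 1 / √((bigRoot l (2 + 2 * cos θ) + 2) ^ 2 - 4 * 1) *
        (bigRoot l (2 + 2 * cos θ) / √(l ^ 2 - 4 * (2 + 2 * cos θ))) := by
  set s := √(l ^ 2 - 16) with hs
  have hs2 : s ^ 2 = l ^ 2 - 16 := sq_sqrt (by nlinarith)
  have hs0 : 0 < s := sqrt_pos.2 (by nlinarith)
  have hsl : s < l := by nlinarith
  set ρ := (l - s) / 2 with hρ
  have hρ0 : 0 < ρ := by rw [hρ]; linarith
  have hρ4 : ρ ^ 2 - l * ρ + 4 = 0 := by rw [hρ]; linear_combination hs2 / 4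
  have hρl : 2 * ρ < l := by rw [hρ]; linarith
  -- the quadratic factor under the root and the derivatives of both substitutions are positive
  have hq : ∀ y ∈ Set.Ioo 0 ρ, 0 < y ^ 2 - l * y + 4 := by
    intro y hy
    nlinarith [mul_pos (sub_pos.2 hy.2) (show 0 < l - ρ - y by linarith [hy.2])]
  have hy1 : ∀ y ∈ Set.Ioo 0 ρ, 0 < l - 2 * y := fun y hy => by linarith [hy.2]
  have hy2 : ∀ y ∈ Set.Ioo 0 ρ, 0 < l + 4 - 2 * y - y ^ 2 := fun y hy => by
    have h1 := hq y hy
    have h2 : y < 1 := by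
      have : ρ < 1 + 0 := by
        rw [hρ]
        have : l - 2 < s := lt_sqrt_of_sq_lt (by nlinarith)
        linarith
      linarith [hy.2]
    nlinarith [hy.1]
  have hL := integral_two_add_two_mul_cos (f := fun y => y * (l + 4 - y) / (1 + y))
    (f' := fun y => (l + 4 - 2 * y - y ^ 2) / (1 + y) ^ 2) hρ0
    (ContinuousOn.div (by fun_prop) (by fun_prop) fun y hy => by linarith [hy.1])
    (fun y hy => by
      have h1 : HasDerivAt (fun y : ℝ => y * (l + 4 - y)) (1 * (l + 4 - y) + y * (-1)) y :=
        (hasDerivAt_id y).mul ((hasDerivAt_id y).const_sub (l + 4))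
      have h2 : HasDerivAt (fun y : ℝ => 1 + y) 1 y := (hasDerivAt_id y).const_add 1
      exact (h1.div h2 (by linarith [hy.1])).congr_deriv (by ring))
    (fun y hy => div_pos (hy2 y hy) (pow_pos (by linarith [hy.1]) 2))
    (by simp)
    (by
      rw [div_eq_iff (by linarith)]
      linear_combination -hρ4)
    (fun t => 1 / √((l + 4 - t) ^ 2 - 4 * t))
  have hR := integral_two_add_two_mul_cos (f := fun y => y * (l - y))
    (f' := fun y => l - 2 * y) hρ0 (by fun_prop)
    (fun y hy => by
      have h1 : HasDerivAt (fun y : ℝ => y * (l - y)) (1 * (l - y) + y * (-1)) y :=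
        (hasDerivAt_id y).mul ((hasDerivAt_id y).const_sub l)
      exact h1.congr_deriv (by ring))
    hy1 (by simp) (by linear_combination -hρ4)
    (fun t => 1 / √((bigRoot l t + 2) ^ 2 - 4 * 1) * (bigRoot l t / √(l ^ 2 - 4 * t)))
  rw [hL, hR]
  refine setIntegral_congr_fun measurableSet_Ioo fun y hy => ?_
  have hy0 := hy.1
  have hq := hq y hy
  have hy1 := hy1 y hy
  have hy2 := hy2 y hy
  have hy3 : 0 < 1 + y := by linarith
  have hy4 : 0 < l - y := by linarith
  have hy5 : 0 < l + 4 - y := by linarith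
  have hbig : bigRoot l (y * (l - y)) = l - y := by
    have := bigRoot_eq_of_add_mul (u := l - y) (v := y) (by linarith)
    rwa [sub_add_cancel, mul_comm] at this
  set K := √(y * (l + 4 - y) * (y ^ 2 - l * y + 4)) with hK
  have hK0 : 0 < K := sqrt_pos.2 (by positivity)
  have e1 : √(y * (l + 4 - y) / (1 + y) * (4 - y * (l + 4 - y) / (1 + y))) = K / (1 + y) := by
    rw [show y * (l + 4 - y) / (1 + y) * (4 - y * (l + 4 - y) / (1 + y)) =
      y * (l + 4 - y) * (y ^ 2 - l * y + 4) / (1 + y) ^ 2 by field_simp; ring,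
      sqrt_div (by positivity), sqrt_sq hy3.le]
  have e2 : √((l + 4 - y * (l + 4 - y) / (1 + y)) ^ 2 - 4 * (y * (l + 4 - y) / (1 + y))) =
      (l + 4 - 2 * y - y ^ 2) / (1 + y) := by
    rw [show (l + 4 - y * (l + 4 - y) / (1 + y)) ^ 2 - 4 * (y * (l + 4 - y) / (1 + y)) =
      ((l + 4 - 2 * y - y ^ 2) / (1 + y)) ^ 2 by field_simp; ring, sqrt_sq (by positivity)]
  have e3 : √(l ^ 2 - 4 * (y * (l - y))) = l - 2 * y := by
    rw [show l ^ 2 - 4 * (y * (l - y)) = (l - 2 * y) ^ 2 by ring, sqrt_sq hy1.le]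
  have e4 : √((l - y + 2) ^ 2 - 4 * 1) * √(y * (l - y) * (4 - y * (l - y))) = (l - y) * K := by
    rw [← sqrt_mul (by nlinarith), show ((l - y + 2) ^ 2 - 4 * 1) * (y * (l - y) *
      (4 - y * (l - y))) = (l - y) ^ 2 * (y * (l + 4 - y) * (y ^ 2 - l * y + 4)) by ring,
      sqrt_mul (by positivity), sqrt_sq hy4.le]
  have hlhs : (l + 4 - 2 * y - y ^ 2) / (1 + y) ^ 2 / (K / (1 + y)) *
      (1 / ((l + 4 - 2 * y - y ^ 2) / (1 + y))) = 1 / K := by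
    field_simp
  have hrhs : ∀ a b : ℝ, a * b = (l - y) * K →
      (l - 2 * y) / b * (1 / a * ((l - y) / (l - 2 * y))) = 1 / K := by
    intro a b hab
    have h : (l - 2 * y) / b * (1 / a * ((l - y) / (l - 2 * y))) = (l - y) / (a * b) := by
      field_simp
    rw [h, hab]
    field_simp
  simp only [e1, e2, hbig, e3]
  rw [hlhs, hrhs _ _ e4]

lemma log_bigRoot_bounds {l t A : ℝ} (hl : 5 < l) (ht : 0 ≤ t) (h1 : l ≤ A) (h2 : A ≤ l + 4)
    (ht4 : t ≤ 4) : log (l - 1) ≤ log (bigRoot A t) ∧ log (bigRoot A t) ≤ log (l + 4) := by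
  have h3 := sub_one_le_bigRoot (A := A) (t := t) (by linarith)
  have h4 := bigRoot_le (A := A) (t := t) (by linarith) ht
  exact ⟨log_le_log (by linarith) (by linarith), log_le_log (by linarith) (by linarith)⟩

/-- The bounds of `log_bigRoot_bounds` hold for the integrand of either side of
`integral_log_bigRoot_eq`. -/
lemma log_bigRoot_bounds_both {l t : ℝ} (hl : 5 < l) (ht : 0 ≤ t) (ht4 : t ≤ 4) :
    (log (l - 1) ≤ log (bigRoot (l + 4 - t) t) ∧ log (bigRoot (l + 4 - t) t) ≤ log (l + 4)) ∧
    log (l - 1) ≤ log (bigRoot (bigRoot l t + 2) 1) ∧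
      log (bigRoot (bigRoot l t + 2) 1) ≤ log (l + 4) := by
  refine ⟨log_bigRoot_bounds hl ht (by linarith) (by linarith) ht4, ?_⟩
  have h3 := sub_one_le_bigRoot (A := l) (t := t) (by linarith)
  have h4 := bigRoot_le (A := l) (t := t) (by linarith) ht
  exact log_bigRoot_bounds hl (by norm_num) (by linarith) (by linarith) (by norm_num)

lemma intervalIntegrable_of_bounds {f : ℝ → ℝ} (hf : Measurable f) {m M a b : ℝ}
    (h : ∀ x, m ≤ f x ∧ f x ≤ M) : IntervalIntegrable f volume a b := by
  refine (intervalIntegrable_const (c := max |m| |M|)).mono_fun' hf.aestronglyMeasurable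
    (Filter.Eventually.of_forall fun x => ?_)
  exact abs_le_max_abs_abs (h x).1 (h x).2

lemma intervalIntegrable_log_bigRoot {l : ℝ} (hl : 5 < l) (a b : ℝ) :
    IntervalIntegrable (fun θ => log (bigRoot (l + 4 - (2 + 2 * cos θ)) (2 + 2 * cos θ)))
        volume a b ∧
      IntervalIntegrable (fun θ => log (bigRoot (bigRoot l (2 + 2 * cos θ) + 2) 1))
        volume a b := by
  have hb := fun θ : ℝ => log_bigRoot_bounds_both hl (two_add_two_mul_cos_mem θ).1
    (two_add_two_mul_cos_mem θ).2
  exact ⟨intervalIntegrable_of_bounds (by fun_prop) fun θ => (hb θ).1,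
    intervalIntegrable_of_bounds (by fun_prop) fun θ => (hb θ).2⟩

lemma one_div_sqrt_le_one {u : ℝ} (hu : 1 ≤ u) : 1 / √u ≤ 1 := by
  rw [div_le_one (sqrt_pos.2 (by linarith))]
  exact one_le_sqrt.2 hu

lemma hasDerivAt_integral_log_bigRoot_sub {l : ℝ} (hl : 5 < l) :
    HasDerivAt (fun l => ∫ θ in 0..π, log (bigRoot (l + 4 - (2 + 2 * cos θ)) (2 + 2 * cos θ)))
      (∫ θ in 0..π, 1 / √((l + 4 - (2 + 2 * cos θ)) ^ 2 - 4 * (2 + 2 * cos θ))) l := by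
  have ht := two_add_two_mul_cos_mem
  have hA : ∀ x ∈ Set.Ioi (5 : ℝ), ∀ θ : ℝ,
      1 ≤ (x + 4 - (2 + 2 * cos θ)) ^ 2 - 4 * (2 + 2 * cos θ) := fun x hx θ => by
    have := ht θ
    have hx' : 5 < x := hx
    nlinarith
  refine (intervalIntegral.hasDerivAt_integral_of_dominated_loc_of_deriv_le
    (F := fun l θ => log (bigRoot (l + 4 - (2 + 2 * cos θ)) (2 + 2 * cos θ)))
    (F' := fun l θ => 1 / √((l + 4 - (2 + 2 * cos θ)) ^ 2 - 4 * (2 + 2 * cos θ)))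
    (bound := fun _ => 1) (Ioi_mem_nhds hl)
    (Filter.Eventually.of_forall fun x => Measurable.aestronglyMeasurable (by fun_prop))
    (intervalIntegrable_log_bigRoot hl 0 π).1 (Measurable.aestronglyMeasurable (by fun_prop)) ?_
    intervalIntegrable_const ?_).2
  · refine Filter.Eventually.of_forall fun θ _ x hx => ?_
    rw [norm_of_nonneg (by positivity)]
    exact one_div_sqrt_le_one (hA x hx θ)
  · refine Filter.Eventually.of_forall fun θ _ x hx => ?_
    have hx' : 5 < x := hx
    have := ht θ
    have h1 : HasDerivAt (fun x : ℝ => x + 4 - (2 + 2 * cos θ)) 1 x :=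
      ((hasDerivAt_id x).add_const 4).sub_const _
    have h2 := (hasDerivAt_log_bigRoot (A := x + 4 - (2 + 2 * cos θ)) (t := 2 + 2 * cos θ)
      (by linarith) (by linarith [hA x hx θ])).comp x h1
    exact h2.congr_deriv (mul_one _)

lemma hasDerivAt_integral_log_bigRoot_bigRoot {l : ℝ} (hl : 5 < l) :
    HasDerivAt (fun l => ∫ θ in 0..π, log (bigRoot (bigRoot l (2 + 2 * cos θ) + 2) 1))
      (∫ θ in 0..π, 1 / √((bigRoot l (2 + 2 * cos θ) + 2) ^ 2 - 4 * 1) *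
        (bigRoot l (2 + 2 * cos θ) / √(l ^ 2 - 4 * (2 + 2 * cos θ)))) l := by
  have ht := two_add_two_mul_cos_mem
  have hA : ∀ x ∈ Set.Ioi (5 : ℝ), ∀ θ : ℝ, 1 ≤ x ^ 2 - 4 * (2 + 2 * cos θ) := fun x hx θ => by
    have := ht θ
    have hx' : 5 < x := hx
    nlinarith
  have hr : ∀ x ∈ Set.Ioi (5 : ℝ), ∀ θ : ℝ, 1 < bigRoot x (2 + 2 * cos θ) := fun x hx θ => by
    have := half_le_bigRoot x (2 + 2 * cos θ)
    have hx' : 5 < x := hx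
    linarith
  refine (intervalIntegral.hasDerivAt_integral_of_dominated_loc_of_deriv_le
    (F := fun l θ => log (bigRoot (bigRoot l (2 + 2 * cos θ) + 2) 1))
    (F' := fun l θ => 1 / √((bigRoot l (2 + 2 * cos θ) + 2) ^ 2 - 4 * 1) *
        (bigRoot l (2 + 2 * cos θ) / √(l ^ 2 - 4 * (2 + 2 * cos θ))))
    (bound := fun _ => 1) (Ioi_mem_nhds hl)
    (Filter.Eventually.of_forall fun x => Measurable.aestronglyMeasurable (by fun_prop))
    (intervalIntegrable_log_bigRoot hl 0 π).2 (Measurable.aestronglyMeasurable (by fun_prop)) ?_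
    intervalIntegrable_const ?_).2
  · refine Filter.Eventually.of_forall fun θ _ x hx => ?_
    have h1 := hr x hx θ
    set r := bigRoot x (2 + 2 * cos θ)
    have h2 : r ≤ √((r + 2) ^ 2 - 4 * 1) := le_sqrt_of_sq_le (by linarith)
    rw [norm_of_nonneg (by positivity)]
    calc 1 / √((r + 2) ^ 2 - 4 * 1) * (r / √(x ^ 2 - 4 * (2 + 2 * cos θ)))
        = r / √((r + 2) ^ 2 - 4 * 1) * (1 / √(x ^ 2 - 4 * (2 + 2 * cos θ))) := by ring
      _ ≤ 1 * 1 := mul_le_mul ((div_le_one (by linarith)).2 h2) (one_div_sqrt_le_one (hA x hx θ))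
          (by positivity) zero_le_one
      _ = 1 := one_mul 1
  · refine Filter.Eventually.of_forall fun θ _ x hx => ?_
    have h1 := hr x hx θ
    have h2 := (hasDerivAt_bigRoot (A := x) (t := 2 + 2 * cos θ)
      (by linarith [hA x hx θ])).add_const 2
    exact (hasDerivAt_log_bigRoot (A := bigRoot x (2 + 2 * cos θ) + 2) (t := 1)
      (by linarith) (by nlinarith)).comp x h2

/-- Both sides have the same derivative in `l`, by `integral_period_eq`, and their difference
tends to `0` as `l` tends to infinity. -/
lemma integral_log_bigRoot_eq {l : ℝ} (hl : 5 < l) :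
    ∫ θ in 0..π, log (bigRoot (l + 4 - (2 + 2 * cos θ)) (2 + 2 * cos θ)) =
      ∫ θ in 0..π, log (bigRoot (bigRoot l (2 + 2 * cos θ) + 2) 1) := by
  set D : ℝ → ℝ := fun l =>
    (∫ θ in 0..π, log (bigRoot (l + 4 - (2 + 2 * cos θ)) (2 + 2 * cos θ))) -
      ∫ θ in 0..π, log (bigRoot (bigRoot l (2 + 2 * cos θ) + 2) 1) with hD
  have hderiv : ∀ x ∈ Set.Ioi (5 : ℝ), HasDerivAt D 0 x := fun x hx => by
    refine ((hasDerivAt_integral_log_bigRoot_sub hx).sub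
      (hasDerivAt_integral_log_bigRoot_bigRoot hx)).congr_deriv ?_
    rw [integral_period_eq hx, sub_self]
  have hconst : ∀ x ∈ Set.Ioi (5 : ℝ), D x = D l := fun x hx =>
    isOpen_Ioi.is_const_of_deriv_eq_zero isPreconnected_Ioi
      (fun y hy => (hderiv y hy).differentiableAt.differentiableWithinAt)
      (fun y hy => (hderiv y hy).deriv) hx hl
  have hbound : ∀ x ∈ Set.Ioi (5 : ℝ), |D x| ≤ (log (x + 4) - log (x - 1)) * π := fun x hx => by
    obtain ⟨i1, i2⟩ := intervalIntegrable_log_bigRoot hx 0 π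
    have h := intervalIntegral.norm_integral_le_of_norm_le_const (a := 0) (b := π)
      (f := fun θ => log (bigRoot (x + 4 - (2 + 2 * cos θ)) (2 + 2 * cos θ)) -
        log (bigRoot (bigRoot x (2 + 2 * cos θ) + 2) 1)) (C := log (x + 4) - log (x - 1))
      fun θ _ => by
        have hb := log_bigRoot_bounds_both hx (two_add_two_mul_cos_mem θ).1
          (two_add_two_mul_cos_mem θ).2
        rw [norm_eq_abs, abs_le]
        constructor <;> linarith [hb.1.1, hb.1.2, hb.2.1, hb.2.2]
    rw [intervalIntegral.integral_sub i1 i2, sub_zero, abs_of_pos pi_pos] at h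
    exact h
  have hlim : Filter.Tendsto (fun x : ℝ => (log (x + 4) - log (x - 1)) * π) Filter.atTop
      (nhds 0) := by
    have h1 : Filter.Tendsto (fun x : ℝ => 5 / (x - 1) * π) Filter.atTop (nhds 0) := by
      have := (Filter.Tendsto.const_div_atTop (r := (5 : ℝ))
        (Filter.tendsto_atTop_add_const_right Filter.atTop (-1 : ℝ) Filter.tendsto_id)).mul_const π
      simpa [sub_eq_add_neg] using this
    refine squeeze_zero' ?_ ?_ h1
    · filter_upwards [Filter.eventually_gt_atTop (5 : ℝ)] with x hx
      exact (abs_nonneg _).trans (hbound x hx)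
    · filter_upwards [Filter.eventually_gt_atTop (5 : ℝ)] with x hx
      refine mul_le_mul_of_nonneg_right ?_ pi_pos.le
      rw [← log_div (by linarith) (by linarith)]
      have hx1 : x - 1 ≠ 0 := by linarith
      refine (log_le_sub_one_of_pos (div_pos (by linarith) (by linarith))).trans_eq ?_
      field_simp
      ring
  have h0 : |D l| ≤ 0 := ge_of_tendsto hlim (by
    filter_upwards [Filter.eventually_gt_atTop (5 : ℝ)] with x hx
    rw [← hconst x hx]
    exact hbound x hx)
  exact sub_eq_zero.1 (abs_nonpos_iff.1 h0)

/-! ### Means of quadratic polynomials over the circle -/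

lemma norm_one_add_le_two {z : ℂ} (hz : ‖z‖ = 1) : ‖1 + z‖ ≤ 2 :=
  (norm_add_le _ _).trans (by rw [norm_one, hz]; norm_num)

lemma sq_norm_one_add_le {z : ℂ} (hz : ‖z‖ = 1) : ‖1 + z‖ ^ 2 ≤ 4 := by
  nlinarith [norm_one_add_le_two hz, norm_nonneg (1 + z)]

lemma circleAverage_log_norm_reciprocal {a : ℂ} {A : ℝ} (hA : A ≠ 0) (h : 2 * ‖a‖ ≤ |A|) :
    circleAverage (fun y => log ‖a * y ^ 2 + A * y + (starRingEnd ℂ) a‖) 0 1 =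
      log (bigRoot |A| (‖a‖ ^ 2)) := by
  wlog hpos : 0 < A generalizing a A
  · have hneg : 0 < -A := neg_pos.2 (lt_of_le_of_ne (not_lt.1 hpos) hA)
    have := this (a := -a) (A := -A) hneg.ne' (by rwa [norm_neg, abs_neg]) hneg
    rw [norm_neg, abs_neg] at this
    rw [← this]
    congr 1
    ext y
    rw [← norm_neg]
    congr 2
    push_cast
    rw [map_neg]
    ring
  rw [abs_of_pos hpos] at h ⊢
  set m := bigRoot A (‖a‖ ^ 2) with hm
  have hm1 : A / 2 ≤ m := half_le_bigRoot _ _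
  have hm0 : 0 < m := by linarith
  have hq : m ^ 2 - A * m + ‖a‖ ^ 2 = 0 :=
    bigRoot_quadratic (by nlinarith [norm_nonneg a])
  have hmC : (m : ℂ) ≠ 0 := by exact_mod_cast hm0.ne'
  have hqC : (m : ℂ) ^ 2 - A * m + a * (starRingEnd ℂ) a = 0 := by
    rw [Complex.mul_conj, Complex.normSq_eq_norm_sq]
    exact_mod_cast hq
  have hfac : ∀ y : ℂ, a * y ^ 2 + A * y + (starRingEnd ℂ) a =
      (a * y + m) * (1 * y + (starRingEnd ℂ) a / m) := by
    intro y
    field_simp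
    linear_combination -y * hqC
  simp_rw [hfac]
  rw [circleAverage_log_norm_linear_mul_linear (Or.inr hmC) (Or.inl one_ne_zero), norm_div,
    Complex.norm_conj, Complex.norm_real, norm_of_nonneg hm0.le, norm_one,
    max_eq_right (by linarith), max_eq_left ((div_le_one hm0).2 (by linarith)), log_one, add_zero]

/-- The hypothesis says that `‖Y₁‖ + ‖Y₂‖ ≥ 1 + ‖Y₁ * Y₂‖` for the roots `Y₁`, `Y₂` of
`Y ^ 2 + B * Y + q ^ 2`, that is, that one of them has absolute value at least `1` and the other at
most `1`.
Both means then equal the logarithm of the absolute value of the larger root. -/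
lemma circleAverage_log_norm_quadratic_eq {B q : ℂ}
    (h : 2 * (1 + ‖q‖ ^ 2) ≤ ‖B - 2 * q‖ + ‖B + 2 * q‖) :
    circleAverage (fun Y => log ‖Y ^ 2 + B * Y + q ^ 2‖) 0 1 =
      circleAverage (fun z => log ‖q * z ^ 2 + B * z + q‖) 0 1 := by
  obtain ⟨δ, hδ⟩ := IsAlgClosed.exists_pow_nat_eq (B ^ 2 - 4 * q ^ 2) zero_lt_two
  obtain ⟨u, v, huv, hmul⟩ : ∃ u v : ℂ, u + v = -B ∧ u * v = q ^ 2 :=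
    ⟨(-B + δ) / 2, (-B - δ) / 2, by ring, by linear_combination -hδ / 4⟩
  -- square roots `a`, `b` of the two roots turn `B ± 2 * q` into the squares `(a ± b) ^ 2`
  have hsum : 1 + ‖q‖ ^ 2 ≤ ‖u‖ + ‖v‖ := by
    obtain ⟨a, ha⟩ := IsAlgClosed.exists_pow_nat_eq u zero_lt_two
    obtain ⟨b, hb⟩ := IsAlgClosed.exists_pow_nat_eq v zero_lt_two
    have hpar : ‖a + b‖ ^ 2 + ‖a - b‖ ^ 2 = 2 * (‖u‖ + ‖v‖) := by
      rw [← ha, ← hb, norm_pow, norm_pow]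
      have := parallelogram_law_with_norm ℝ a b
      linear_combination this
    rw [← norm_pow, ← norm_pow] at hpar
    have hab : (a * b - q) * (a * b + q) = 0 := by
      linear_combination hmul + b ^ 2 * ha + u * hb
    rcases mul_eq_zero.1 hab with h1 | h1
    · have e1 : (a + b) ^ 2 = -(B - 2 * q) := by linear_combination ha + hb + huv + 2 * h1
      have e2 : (a - b) ^ 2 = -(B + 2 * q) := by linear_combination ha + hb + huv - 2 * h1
      rw [e1, e2, norm_neg, norm_neg] at hpar
      linarith
    · have e1 : (a + b) ^ 2 = -(B + 2 * q) := by linear_combination ha + hb + huv + 2 * h1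
      have e2 : (a - b) ^ 2 = -(B - 2 * q) := by linear_combination ha + hb + huv - 2 * h1
      rw [e1, e2, norm_neg, norm_neg] at hpar
      linarith
  clear hδ h
  wlog hle : ‖v‖ ≤ ‖u‖ generalizing u v
  · exact this v u (by rw [add_comm, huv]) (by rw [mul_comm, hmul]) (by rwa [add_comm ‖v‖])
      (not_le.1 hle).le
  have hprod : ‖u‖ * ‖v‖ = ‖q‖ ^ 2 := by rw [← norm_mul, hmul, norm_pow]
  have hv1 : ‖v‖ ≤ 1 := by
    by_contra hv
    nlinarith
  have hu1 : 1 ≤ ‖u‖ := by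
    by_contra hu
    nlinarith
  have hu0 : u ≠ 0 := norm_pos_iff.1 (by linarith)
  have hqu : ‖q‖ ≤ ‖u‖ := by
    refine abs_le_of_sq_le_sq' ?_ (norm_nonneg _) |>.2
    rw [← hprod]
    nlinarith
  have f1 : ∀ Y : ℂ, Y ^ 2 + B * Y + q ^ 2 = (1 * Y + -u) * (1 * Y + -v) := fun Y => by
    linear_combination Y * huv - hmul
  have f2 : ∀ z : ℂ, q * z ^ 2 + B * z + q = (q * z + -u) * (1 * z + -(q / u)) := fun z => by
    have h1 : q / u * u = q := div_mul_cancel₀ q hu0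
    have h2 : q * (q / u) = v := by field_simp; linear_combination -hmul
    linear_combination z * huv - h1 + z * h2
  simp_rw [f1, f2]
  rw [circleAverage_log_norm_linear_mul_linear (Or.inl one_ne_zero) (Or.inl one_ne_zero),
    circleAverage_log_norm_linear_mul_linear (Or.inr (neg_ne_zero.2 hu0)) (Or.inl one_ne_zero),
    norm_neg, norm_neg, norm_neg, norm_one, norm_div, max_eq_right hu1, max_eq_left hv1,
    max_eq_right hqu, max_eq_left ((div_le_one (by linarith)).2 hqu)]

lemma circleAverage_log_norm_sub_mul_sub (u v : ℂ) :
    circleAverage (fun z => log ‖(z - u) * (z - v)‖) 0 1 =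
      log (max 1 ‖u‖) + log (max 1 ‖v‖) := by
  have := circleAverage_log_norm_linear_mul_linear (a := 1) (b := -u) (c := 1) (d := -v)
    (Or.inl one_ne_zero) (Or.inl one_ne_zero)
  simpa [sub_eq_add_neg] using this

lemma circleAverage_log_norm_sub_mul_add {s : ℝ} {u v : ℂ} (h1 : u + v = s) (h2 : u * v = s) :
    circleAverage (fun z : ℂ => log ‖z ^ 2 - s * z + s‖) 0 1 =
      log (max 1 ‖u‖) + log (max 1 ‖v‖) := by
  rw [← circleAverage_log_norm_sub_mul_sub]
  congr 1
  ext z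
  congr 2
  linear_combination z * h1 - h2

lemma circleAverage_log_norm_of_nonneg_of_lt_four {s : ℝ} (h0 : 0 ≤ s) (h4 : s < 4) :
    circleAverage (fun z : ℂ => log ‖z ^ 2 - s * z + s‖) 0 1 = 2 * log (max 1 √s) := by
  have hw : √(4 * s - s ^ 2) ^ 2 = 4 * s - s ^ 2 := sq_sqrt (by nlinarith)
  set w := √(4 * s - s ^ 2)
  have hu : ∀ e : ℝ, e ^ 2 = 1 → ‖(⟨s / 2, e * w / 2⟩ : ℂ)‖ = √s := by
    intro e he
    rw [Complex.norm_def, Complex.normSq_mk]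
    congr 1
    linear_combination (e ^ 2 / 4) * hw + (s - s ^ 2 / 4) * he
  rw [circleAverage_log_norm_sub_mul_add (u := ⟨s / 2, 1 * w / 2⟩) (v := ⟨s / 2, (-1) * w / 2⟩),
    hu 1 (by norm_num), hu (-1) (by norm_num), two_mul]
  · apply Complex.ext
    · simp
    · simp
      ring
  · apply Complex.ext <;> simp
    · linear_combination hw / 4
    · ring

lemma circleAverage_log_norm_of_le_one {s : ℝ} (h0 : 0 ≤ s) (h1 : s ≤ 1) :
    circleAverage (fun z : ℂ => log ‖z ^ 2 - s * z + s‖) 0 1 = 0 := by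
  rw [circleAverage_log_norm_of_nonneg_of_lt_four h0 (by linarith),
    max_eq_left (sqrt_le_one.2 h1), log_one, mul_zero]

lemma circleAverage_log_norm_of_one_le {s : ℝ} (h1 : 1 ≤ s) :
    circleAverage (fun z : ℂ => log ‖z ^ 2 - s * z + s‖) 0 1 = log s := by
  rcases lt_or_ge s 4 with h4 | h4
  · rw [circleAverage_log_norm_of_nonneg_of_lt_four (by linarith) h4,
      max_eq_right (one_le_sqrt.2 h1), log_sqrt (by linarith)]
    ring
  · have hq := bigRoot_quadratic (A := s) (t := s) (by nlinarith)
    have hu := half_le_bigRoot s s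
    set u := bigRoot s s
    have hu1 : 1 < u := by linarith
    have hv1 : 1 < s - u := by
      have : (u - 1) * (s - u - 1) = 1 := by linear_combination -hq
      nlinarith
    rw [circleAverage_log_norm_sub_mul_add (u := (u : ℂ)) (v := ((s - u : ℝ) : ℂ)),
      Complex.norm_real, Complex.norm_real, norm_of_nonneg (by linarith),
      norm_of_nonneg (by linarith), max_eq_right hu1.le, max_eq_right hv1.le,
      ← log_mul (by linarith) (by linarith)]
    · congr 1
      linear_combination -hq
    · push_cast
      ring
    · norm_cast
      linear_combination -hq

lemma circleAverage_log_norm_of_neg {r : ℝ} (h0 : 0 ≤ r) :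
    circleAverage (fun z : ℂ => log ‖z ^ 2 - (-r : ℝ) * z + (-r : ℝ)‖) 0 1 =
      log (max 1 ((r + √(r ^ 2 + 4 * r)) / 2)) := by
  have hw : √(r ^ 2 + 4 * r) ^ 2 = r ^ 2 + 4 * r := sq_sqrt (by positivity)
  have h1 : r ≤ √(r ^ 2 + 4 * r) := le_sqrt_of_sq_le (by linarith)
  have h2 : √(r ^ 2 + 4 * r) ≤ r + 2 := sqrt_le_iff.2 ⟨by linarith, by linarith⟩
  set w := √(r ^ 2 + 4 * r)
  rw [circleAverage_log_norm_sub_mul_add (u := ((-((r + w) / 2) : ℝ) : ℂ))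
    (v := (((w - r) / 2 : ℝ) : ℂ)), Complex.norm_real, Complex.norm_real, norm_neg,
    norm_of_nonneg (by linarith), norm_of_nonneg (by linarith),
    max_eq_left (a := 1) (b := (w - r) / 2) (by linarith), log_one, add_zero]
  · norm_cast
    ring
  · norm_cast
    linear_combination -hw / 4

lemma circleAverage_log_norm_of_neg_of_le_half {r : ℝ} (h0 : 0 ≤ r) (h1 : r ≤ 1 / 2) :
    circleAverage (fun z : ℂ => log ‖z ^ 2 - (-r : ℝ) * z + (-r : ℝ)‖) 0 1 = 0 := by
  have : √(r ^ 2 + 4 * r) ≤ 2 - r := sqrt_le_iff.2 ⟨by linarith, by linarith⟩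
  rw [circleAverage_log_norm_of_neg h0, max_eq_left (by linarith), log_one]

/-- If `X₁`, `X₂` are the roots of `z ^ 2 + r * z - r`, with `|X₁| ≥ 1 ≥ |X₂|`, then
`log |X₁| = (log |X₁ * X₂| + log |X₁ / X₂|) / 2`, where `X₁ * X₂ = -r` and `V = -X₁ / X₂`
satisfies `V + V⁻¹ = r + 2`. -/
lemma circleAverage_log_norm_of_neg_of_half_le {r : ℝ} (h1 : 1 / 2 ≤ r) :
    circleAverage (fun z : ℂ => log ‖z ^ 2 - (-r : ℝ) * z + (-r : ℝ)‖) 0 1 =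
      1 / 2 * (log r + log (bigRoot (r + 2) 1)) := by
  have h3 : |2 - r| ≤ √(r ^ 2 + 4 * r) := abs_le_sqrt (by linarith)
  have h4 := le_of_abs_le h3
  have hb := half_le_bigRoot (r + 2) 1
  have hw : √(r ^ 2 + 4 * r) ^ 2 = r ^ 2 + 4 * r := sq_sqrt (by positivity)
  rw [circleAverage_log_norm_of_neg (by linarith), max_eq_right (by linarith),
    ← log_mul (by linarith) (by linarith),
    show r * bigRoot (r + 2) 1 = ((r + √(r ^ 2 + 4 * r)) / 2) ^ 2 by
      rw [bigRoot, show (r + 2) ^ 2 - 4 * 1 = r ^ 2 + 4 * r by ring]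
      linear_combination -hw / 4,
    log_pow]
  push_cast
  ring

open Polynomial in
/-- The quartic `X² (X² + l X - l) + t (X - 1)²` factors as the product of `X² - s X + s` over the
two roots `s` of `s² + l s + t`. -/
lemma circleAverage_log_norm_quartic {l t s₁ s₂ : ℝ} (h1 : s₁ + s₂ = -l) (h2 : s₁ * s₂ = t) :
    circleAverage (fun X : ℂ => log ‖X ^ 2 * (X ^ 2 + l * X - l) + t * (X - 1) ^ 2‖) 0 1 =
      circleAverage (fun z : ℂ => log ‖z ^ 2 - s₁ * z + s₁‖) 0 1 +
        circleAverage (fun z : ℂ => log ‖z ^ 2 - s₂ * z + s₂‖) 0 1 := by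
  have h1' : (s₁ : ℂ) + s₂ = -l := by exact_mod_cast h1
  have h2' : (s₁ : ℂ) * s₂ = t := by exact_mod_cast h2
  have hm : ∀ s : ℂ, (X ^ 2 - C s * X + C s : ℂ[X]).Monic := fun s => by monicity!
  have key := logMahlerMeasure_mul_eq_add_logMahlerMeasure
    (mul_ne_zero (hm s₁).ne_zero (hm s₂).ne_zero)
  simp only [logMahlerMeasure_def, eval_mul, eval_add, eval_sub, eval_pow, eval_X, eval_C] at key
  rw [← key]
  congr 1
  ext z
  congr 2
  linear_combination (z ^ 2 * (z - 1)) * h1' - (z - 1) ^ 2 * h2'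

lemma circleAverage_congr_unit {f g : ℂ → ℝ} (h : ∀ z, ‖z‖ = 1 → f z = g z) :
    circleAverage f 0 1 = circleAverage g 0 1 :=
  circleAverage_congr_sphere fun z hz => h z (by simpa using hz)

/-! ### The family `R` -/

lemma R_ne_zero {l : ℝ} (hl : 5 ≤ |l|) {x y : ℂ} (hx : ‖x‖ = 1) (hy : ‖y‖ = 1) : R l x y ≠ 0 := by
  intro h
  have h1 : (l : ℂ) = -(x + x⁻¹ + y + y⁻¹) := by
    unfold R at h
    linear_combination h
  have h2 : ‖x + x⁻¹ + y + y⁻¹‖ ≤ ‖x‖ + ‖x⁻¹‖ + ‖y‖ + ‖y⁻¹‖ := norm_add₄_le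
  rw [norm_inv, norm_inv, hx, hy, ← norm_neg, ← h1, Complex.norm_real, norm_eq_abs] at h2
  norm_num at h2
  linarith

lemma hasMahlerMeasure_R {l : ℝ} (hl : 5 ≤ |l|) : HasMahlerMeasure (R l) := by
  refine hasMahlerMeasure_of_ne_zero ?_ fun x y hx hy => R_ne_zero hl hx hy
  simp only [R, ← Complex.exp_neg]
  fun_prop

/-- The substitution `x = y * w` turns `y * R` into the self-reciprocal quadratic polynomial
`(1 + w) * y ^ 2 + l * y + (1 + conj w)` in `y`. -/
lemma mahler_R {l : ℝ} (hl : 5 ≤ |l|) :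
    mahler (R l) = circleAverage (fun w => log (bigRoot |l| (‖1 + w‖ ^ 2))) 0 1 := by
  have hG : HasMahlerMeasure fun y w => R l (y * w) y := by
    refine hasMahlerMeasure_of_ne_zero ?_ fun y w hy hw =>
      R_ne_zero hl (by rw [norm_mul, hy, hw, one_mul]) hy
    simp only [R, ← Complex.exp_neg, mul_inv]
    fun_prop
  rw [← mahler_swap, mahler_eq_circleAverage (hasMahlerMeasure_R hl).swap]
  calc circleAverage (fun y => circleAverage (fun x => log ‖R l x y‖) 0 1) 0 1
      = circleAverage (fun y => circleAverage (fun w => log ‖R l (y * w) y‖) 0 1) 0 1 :=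
        circleAverage_congr_unit fun y hy =>
          (circleAverage_mul_left (fun x => log ‖R l x y‖) hy).symm
    _ = circleAverage (fun w => circleAverage (fun y => log ‖R l (y * w) y‖) 0 1) 0 1 := by
        rw [← mahler_eq_circleAverage hG, ← mahler_swap, mahler_eq_circleAverage hG.swap]
    _ = _ := circleAverage_congr_unit fun w hw => by
        rw [← circleAverage_log_norm_reciprocal (a := 1 + w) (A := l)
          (abs_pos.1 (by linarith)) (by linarith [norm_one_add_le_two hw])]
        refine circleAverage_congr_unit fun y hy => ?_
        have hy0 : y ≠ 0 := norm_pos_iff.1 (by rw [hy]; exact one_pos)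
        have hw0 : w ≠ 0 := norm_pos_iff.1 (by rw [hw]; exact one_pos)
        have e : (1 + w) * y ^ 2 + l * y + (starRingEnd ℂ) (1 + w) = y * R l (y * w) y := by
          rw [map_add, map_one, ← Complex.inv_eq_conj hw, R]
          field_simp
          ring
        rw [e, norm_mul, hy, one_mul]

/-! ### The family `P` -/

lemma sq_norm_one_add {x : ℂ} (hx : ‖x‖ = 1) : ‖1 + x‖ ^ 2 = 2 + 2 * x.re := by
  have h : x.re * x.re + x.im * x.im = 1 := by
    rw [← Complex.normSq_apply, Complex.normSq_eq_norm_sq, hx, one_pow]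
  rw [← Complex.normSq_eq_norm_sq, Complex.normSq_apply]
  simp only [Complex.add_re, Complex.one_re, Complex.add_im, Complex.one_im]
  linear_combination h

lemma norm_P {l : ℝ} {x y : ℂ} (hx : ‖x‖ = 1) :
    ‖P l x y‖ = ‖(starRingEnd ℂ) (1 + x) * y ^ 2 + ((‖1 + x‖ ^ 2 - (l + 4) : ℝ) : ℂ) * y +
      (starRingEnd ℂ) ((starRingEnd ℂ) (1 + x))‖ := by
  have hx0 : x ≠ 0 := norm_pos_iff.1 (by rw [hx]; exact one_pos)
  have h1 : ((‖1 + x‖ ^ 2 : ℝ) : ℂ) = (1 + x) * (1 + x⁻¹) := by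
    rw [← Complex.normSq_eq_norm_sq, ← Complex.mul_conj, map_add, map_one,
      ← Complex.inv_eq_conj hx]
  have e : P l x y = x * ((starRingEnd ℂ) (1 + x) * y ^ 2 +
      ((‖1 + x‖ ^ 2 - (l + 4) : ℝ) : ℂ) * y + (starRingEnd ℂ) ((starRingEnd ℂ) (1 + x))) := by
    rw [Complex.conj_conj, Complex.ofReal_sub, h1, map_add, map_one, ← Complex.inv_eq_conj hx, P]
    field_simp
    push_cast
    ring
  rw [e, norm_mul, hx, one_mul]

lemma hasMahlerMeasure_P {l : ℝ} (hl : 13 ≤ l) : HasMahlerMeasure (P l) := by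
  refine hasMahlerMeasure_of_ne_zero (by unfold P; fun_prop) fun x y hx hy h => ?_
  have h1 := norm_P (l := l) (y := y) hx
  rw [h, norm_zero] at h1
  have h2 := norm_one_add_le_two hx
  have h3 := sq_norm_one_add_le hx
  set a := (starRingEnd ℂ) (1 + x) with ha
  have ha' : ‖a‖ = ‖1 + x‖ := Complex.norm_conj _
  have h4 := norm_eq_zero.1 h1.symm
  have h5 : ((‖1 + x‖ ^ 2 - (l + 4) : ℝ) : ℂ) * y = -(a * y ^ 2 + (starRingEnd ℂ) a) := by
    linear_combination h4
  have h6 := norm_add_le (a * y ^ 2) ((starRingEnd ℂ) a)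
  rw [← norm_neg, ← h5, norm_mul, norm_mul, norm_pow, hy, Complex.norm_real, Complex.norm_conj a,
    ha', norm_eq_abs, abs_of_nonpos (by linarith)] at h6
  linarith

lemma mahler_P {l : ℝ} (hl : 13 ≤ l) :
    mahler (P l) =
      circleAverage (fun x => log (bigRoot (l + 4 - ‖1 + x‖ ^ 2) (‖1 + x‖ ^ 2))) 0 1 := by
  rw [mahler_eq_circleAverage (hasMahlerMeasure_P hl)]
  refine circleAverage_congr_unit fun x hx => ?_
  have h2 := norm_one_add_le_two hx
  have h3 := sq_norm_one_add_le hx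
  simp_rw [norm_P hx]
  rw [circleAverage_log_norm_reciprocal (by linarith)
    (by rw [Complex.norm_conj, abs_of_nonpos (by linarith)]; linarith), Complex.norm_conj,
    abs_of_nonpos (by linarith), neg_sub]

/-! ### The shifted hyperelliptic family -/

/-- With `d = 1 - Re X`, the two summands on the right-hand side have squares `N₁`, `N₂` that are
polynomials in `d`, and the claim follows from the factorisation of
`N₁ * N₂ - (2 * (1 + 4 * d ^ 2) ^ 2 - (N₁ + N₂) / 2) ^ 2`. -/
lemma two_mul_one_add_sq_le {l : ℝ} (hl : l ≤ -5 ∨ 13 ≤ l) {X : ℂ} (hX : ‖X‖ = 1) :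
    2 * (1 + ‖(X - 1) ^ 2‖ ^ 2) ≤ ‖X ^ 2 * (X ^ 2 + l * X - l)‖ +
      ‖X ^ 2 * (X ^ 2 + l * X - l) + 4 * (X - 1) ^ 2‖ := by
  obtain ⟨c, hc⟩ : ∃ c : ℝ, c = X.re := ⟨_, rfl⟩
  have hcs : X.re * X.re + X.im * X.im = 1 := by
    rw [← Complex.normSq_apply, Complex.normSq_eq_norm_sq, hX, one_pow]
  have hX2 : X ^ 2 = 2 * c * X - 1 := by
    rw [hc]
    apply Complex.ext
    · simp [pow_two]
      linear_combination -hcs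
    · simp [pow_two]
      ring
  -- the squared absolute value of a polynomial in `X` that is reduced modulo `X² - 2 c X + 1`
  have hlin : ∀ α β : ℝ, ‖(α * X + β : ℂ)‖ ^ 2 = α ^ 2 + β ^ 2 + 2 * α * β * c := by
    intro α β
    rw [← Complex.normSq_eq_norm_sq, Complex.normSq_apply, hc]
    simp
    linear_combination α ^ 2 * hcs
  have hc1 : |c| ≤ 1 := by
    rw [hc, ← hX]
    exact Complex.abs_re_le_norm X
  obtain ⟨d, hd⟩ : ∃ d : ℝ, d = 1 - c := ⟨_, rfl⟩
  have hd0 : 0 ≤ d := by linarith [le_of_abs_le hc1]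
  have hd2 : d ≤ 2 := by linarith [neg_le_of_abs_le hc1]
  obtain rfl : c = 1 - d := by linarith
  have hq : ‖(X - 1) ^ 2‖ = 2 * d := by
    have := hlin 1 (-1)
    rw [norm_pow, show X - 1 = ((1 : ℝ) : ℂ) * X + ((-1 : ℝ) : ℂ) by push_cast; ring, this]
    ring
  have hN1 : ‖X ^ 2 * (X ^ 2 + l * X - l)‖ ^ 2 =
      1 + (2 * l ^ 2 + 6 * l) * d - 4 * l * d ^ 2 := by
    have := hlin (2 * (1 - d) + l) (-1 - l)
    rw [norm_mul, norm_pow, hX, one_pow, one_mul,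
      show X ^ 2 + l * X - l = ((2 * (1 - d) + l : ℝ) : ℂ) * X + ((-1 - l : ℝ) : ℂ) by
        push_cast
        push_cast at hX2
        linear_combination hX2, this]
    ring
  have hN2 : ‖X ^ 2 * (X ^ 2 + l * X - l) + 4 * (X - 1) ^ 2‖ ^ 2 =
      1 + (2 * l ^ 2 + 6 * l - 16) * d + (208 + 44 * l) * d ^ 2 - (32 * l + 192) * d ^ 3 +
        64 * d ^ 4 := by
    have := hlin (8 * (1 - d) ^ 3 - 4 * (1 - d) + l * (4 * (1 - d) ^ 2 - 1) +
      (4 - l) * (2 * (1 - d)) - 8) (-(4 * (1 - d) ^ 2 - 1) - 2 * l * (1 - d) - (4 - l) + 4)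
    rw [show X ^ 2 * (X ^ 2 + l * X - l) + 4 * (X - 1) ^ 2 =
      ((8 * (1 - d) ^ 3 - 4 * (1 - d) + l * (4 * (1 - d) ^ 2 - 1) +
      (4 - l) * (2 * (1 - d)) - 8 : ℝ) : ℂ) * X +
      ((-(4 * (1 - d) ^ 2 - 1) - 2 * l * (1 - d) - (4 - l) + 4 : ℝ) : ℂ) by
        push_cast
        push_cast at hX2
        linear_combination (X ^ 2 + l * X + (4 - l) + 2 * (1 - d) * X + 4 * (1 - d) ^ 2 - 1
          + 2 * l * (1 - d)) * hX2, this]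
    ring
  rw [hq]
  set N := ‖X ^ 2 * (X ^ 2 + l * X - l)‖
  set M := ‖X ^ 2 * (X ^ 2 + l * X - l) + 4 * (X - 1) ^ 2‖
  have hN0 : 0 ≤ N := norm_nonneg _
  have hM0 : 0 ≤ M := norm_nonneg _
  set T := 2 * (1 + 4 * d ^ 2) ^ 2 - (N ^ 2 + M ^ 2) / 2 with hT
  have hfac : (N * M) ^ 2 - T ^ 2 = d * (2 * d - 1) ^ 2 * (8 * ((l + 4) * ((l - 1) +
      2 * (2 * l + 3) * d + 20 * (l + 3) * d ^ 2 - 8 * (l + 9) * d ^ 3))) := by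
    rw [hT, mul_pow, hN1, hN2]
    ring
  have hpos : 0 ≤ (l + 4) * ((l - 1) + 2 * (2 * l + 3) * d + 20 * (l + 3) * d ^ 2 -
      8 * (l + 9) * d ^ 3) := by
    have hd3 : d ^ 3 ≤ 2 * d ^ 2 := by nlinarith [sq_nonneg d]
    rcases hl with hl | hl
    · refine mul_nonneg_of_nonpos_of_nonpos (by linarith) ?_
      have h1 : 0 ≤ (-5 - l) * (2 * d ^ 2 - d ^ 3) := mul_nonneg (by linarith) (by linarith)
      have h2 : 0 ≤ (-5 - l) * d := mul_nonneg (by linarith) hd0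
      have h3 : 0 ≤ (-5 - l) * d ^ 2 := mul_nonneg (by linarith) (sq_nonneg d)
      have h4 : 0 ≤ d ^ 3 := pow_nonneg hd0 3
      nlinarith [sq_nonneg d]
    · refine mul_nonneg (by linarith) ?_
      have h1 : 0 ≤ (l - 13) * (2 * d ^ 2 - d ^ 3) := mul_nonneg (by linarith) (by linarith)
      have h2 : 0 ≤ (l - 13) * d := mul_nonneg (by linarith) hd0
      have h3 : 0 ≤ (l - 13) * d ^ 2 := mul_nonneg (by linarith) (sq_nonneg d)
      have h4 : 0 ≤ d * (2 - d) := mul_nonneg hd0 (by linarith)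
      nlinarith
  have hTNM : T ≤ N * M := by
    refine abs_le_of_sq_le_sq' (b := N * M) ?_ (mul_nonneg hN0 hM0) |>.2
    rw [← sub_nonneg, hfac]
    positivity
  have hsq : (2 * (1 + (2 * d) ^ 2)) ^ 2 ≤ (N + M) ^ 2 := by
    rw [hT] at hTNM
    linarith
  exact (abs_le_of_sq_le_sq' hsq (by positivity)).2

/-- The constant `q = (X - 1) ^ 2` and the coefficient `B` of `Y` in the shifted family satisfy
`B = 2 * q + X ^ 2 * (X ^ 2 + l * X - l)`. -/
lemma shiftedQ_eq (l : ℝ) (X Y : ℂ) :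
    shiftedQ l X Y = Y ^ 2 + (X ^ 2 * (X ^ 2 + l * X - l) + 2 * (X - 1) ^ 2) * Y +
      ((X - 1) ^ 2) ^ 2 := by
  unfold shiftedQ Q
  push_cast
  ring

open Polynomial in
lemma hasMahlerMeasure_shiftedQ (l : ℝ) : HasMahlerMeasure (shiftedQ l) := by
  refine hasMahlerMeasure_of_polynomial (by unfold shiftedQ Q; fun_prop)
    (fun x => X ^ 2 + C (x ^ 2 * (x ^ 2 + l * x - l) + 2 * (x - 1) ^ 2) * X +
      C (((x - 1) ^ 2) ^ 2)) (fun x _ => ?_) fun x y _ _ => ?_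
  · rw [Monic.leadingCoeff (by monicity!), norm_one]
  · rw [shiftedQ_eq]
    simp

/-- The auxiliary function whose slices over `z` and over `X` link the shifted hyperelliptic family
to `R` and `P`: it arises from `shiftedQ` by replacing `Y` with `(X - 1) ^ 2 * z` and dividing by
`(X - 1) ^ 2 * z`, when `z` is on the unit circle. -/
noncomputable def linkingQuartic (l : ℝ) (X z : ℂ) : ℂ :=
  X ^ 2 * (X ^ 2 + l * X - l) + (‖1 + z‖ ^ 2 : ℝ) * (X - 1) ^ 2

open Polynomial in
lemma hasMahlerMeasure_linkingQuartic (l : ℝ) : HasMahlerMeasure (linkingQuartic l) := by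
  refine HasMahlerMeasure.swap (F := fun z x => linkingQuartic l x z) ?_
  refine hasMahlerMeasure_of_polynomial (by unfold linkingQuartic; fun_prop)
    (fun z => X ^ 2 * (X ^ 2 + C (l : ℂ) * X - C (l : ℂ)) + C ((‖1 + z‖ ^ 2 : ℝ) : ℂ) *
      (X - 1) ^ 2) (fun z _ => ?_) fun z x _ _ => ?_
  · have h : (X ^ 2 * (X ^ 2 + C (l : ℂ) * X - C (l : ℂ)) + C ((‖1 + z‖ ^ 2 : ℝ) : ℂ) *
      (X - 1) ^ 2 : ℂ[X]).Monic := by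
      monicity!
    rw [h.leadingCoeff, norm_one]
  · simp [linkingQuartic]

lemma mahler_shiftedQ_eq_linkingQuartic {l : ℝ} (hl : l ≤ -5 ∨ 13 ≤ l) :
    mahler (shiftedQ l) = mahler (linkingQuartic l) := by
  rw [mahler_eq_circleAverage (hasMahlerMeasure_shiftedQ l),
    mahler_eq_circleAverage (hasMahlerMeasure_linkingQuartic l)]
  refine circleAverage_congr_unit fun X hX => ?_
  simp_rw [shiftedQ_eq]
  rw [circleAverage_log_norm_quadratic_eq]
  · refine circleAverage_congr_unit fun z hz => ?_
    have hz0 : z ≠ 0 := norm_pos_iff.1 (by rw [hz]; exact one_pos)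
    have h1 : ((‖1 + z‖ ^ 2 : ℝ) : ℂ) = (1 + z) * (1 + z⁻¹) := by
      rw [← Complex.normSq_eq_norm_sq, ← Complex.mul_conj, map_add, map_one,
        ← Complex.inv_eq_conj hz]
    rw [show (X - 1) ^ 2 * z ^ 2 + (X ^ 2 * (X ^ 2 + l * X - l) + 2 * (X - 1) ^ 2) * z +
      (X - 1) ^ 2 = z * linkingQuartic l X z by
        rw [linkingQuartic, h1]
        field_simp
        ring, norm_mul, hz, one_mul]
  · convert two_mul_one_add_sq_le hl hX using 3 <;> ring

lemma mahler_shiftedQ {l : ℝ} (hl : l ≤ -5 ∨ 13 ≤ l) :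
    mahler (shiftedQ l) =
      circleAverage (fun z => circleAverage (fun X => log ‖linkingQuartic l X z‖) 0 1) 0 1 := by
  rw [mahler_shiftedQ_eq_linkingQuartic hl, ← mahler_swap,
    mahler_eq_circleAverage (hasMahlerMeasure_linkingQuartic l).swap]

lemma circleAverage_linkingQuartic_of_le {l : ℝ} (hl : l ≤ -5) {z : ℂ} (hz : ‖z‖ = 1) :
    circleAverage (fun X => log ‖linkingQuartic l X z‖) 0 1 =
      log (bigRoot |l| (‖1 + z‖ ^ 2)) := by
  have ht := sq_norm_one_add_le hz
  have ht0 : 0 ≤ ‖1 + z‖ ^ 2 := by positivity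
  unfold linkingQuartic
  set t := ‖1 + z‖ ^ 2
  rw [abs_of_nonpos (by linarith)]
  have hq := bigRoot_quadratic (A := -l) (t := t) (by nlinarith)
  have h1 := half_le_bigRoot (-l) t
  have h2 := bigRoot_le (A := -l) (t := t) (by linarith) ht0
  have h3 := sub_one_le_bigRoot (A := -l) (t := t) (by linarith)
  set s := bigRoot (-l) t
  rw [circleAverage_log_norm_quartic (s₁ := s) (s₂ := -l - s) (by ring)
    (by linear_combination -hq), circleAverage_log_norm_of_one_le (by linarith),
    circleAverage_log_norm_of_le_one (by linarith) (by linarith), add_zero]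

lemma circleAverage_linkingQuartic_of_ge {l : ℝ} (hl : 13 ≤ l) {z : ℂ} (hz : ‖z‖ = 1) :
    circleAverage (fun X => log ‖linkingQuartic l X z‖) 0 1 =
      1 / 2 * (log (bigRoot |l| (‖1 + z‖ ^ 2)) +
        log (bigRoot (bigRoot l (‖1 + z‖ ^ 2) + 2) 1)) := by
  have ht := sq_norm_one_add_le hz
  have ht0 : 0 ≤ ‖1 + z‖ ^ 2 := by positivity
  unfold linkingQuartic
  set t := ‖1 + z‖ ^ 2
  rw [abs_of_nonneg (by linarith)]
  have hq := bigRoot_quadratic (A := l) (t := t) (by nlinarith)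
  have h1 := half_le_bigRoot l t
  have h2 := bigRoot_le (A := l) (t := t) (by linarith) ht0
  set r := bigRoot l t
  have h3 : l - r ≤ 1 / 2 := by nlinarith
  rw [circleAverage_log_norm_quartic (s₁ := -r) (s₂ := -(l - r)) (by ring)
    (by linear_combination -hq), circleAverage_log_norm_of_neg_of_half_le (by linarith),
    circleAverage_log_norm_of_neg_of_le_half (by linarith) h3, add_zero]

/-! ### Comparison of the means over the angle -/

lemma circleAverage_sq_norm_one_add (g : ℝ → ℝ) :
    circleAverage (fun z => g (‖1 + z‖ ^ 2)) 0 1 =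
      (2 * π)⁻¹ * ∫ θ in 0..2 * π, g (2 + 2 * cos θ) := by
  rw [circleAverage_def, smul_eq_mul]
  congr 2
  ext θ
  rw [sq_norm_one_add (by simp), ← exp_mul_I_eq_circleMap, Complex.exp_ofReal_mul_I_re]

lemma integral_two_pi_eq_two_mul {f : ℝ → ℝ} (hf : ∀ a b, IntervalIntegrable f volume a b)
    (h : ∀ θ, f (2 * π - θ) = f θ) : ∫ θ in 0..2 * π, f θ = 2 * ∫ θ in 0..π, f θ := by
  rw [← intervalIntegral.integral_add_adjacent_intervals (hf 0 π) (hf π (2 * π))]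
  have := intervalIntegral.integral_comp_sub_left (a := 0) (b := π) f (2 * π)
  simp only [h] at this
  rw [this, sub_zero, show 2 * π - π = π by ring]
  ring

lemma circleAverage_log_bigRoot_eq {l : ℝ} (hl : 5 < l) :
    circleAverage (fun z => log (bigRoot (bigRoot l (‖1 + z‖ ^ 2) + 2) 1)) 0 1 =
      circleAverage (fun z => log (bigRoot (l + 4 - ‖1 + z‖ ^ 2) (‖1 + z‖ ^ 2))) 0 1 := by
  have hi := intervalIntegrable_log_bigRoot hl
  have h1 := circleAverage_sq_norm_one_add fun t => log (bigRoot (bigRoot l t + 2) 1)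
  have h2 := circleAverage_sq_norm_one_add fun t => log (bigRoot (l + 4 - t) t)
  rw [integral_two_pi_eq_two_mul (fun a b => (hi a b).2) (by simp [cos_two_pi_sub])] at h1
  rw [integral_two_pi_eq_two_mul (fun a b => (hi a b).1) (by simp [cos_two_pi_sub])] at h2
  rw [h1, h2, integral_log_bigRoot_eq hl]

lemma circleIntegrable_log_bigRoot {l : ℝ} (hl : 5 < l) :
    CircleIntegrable (fun z => log (bigRoot |l| (‖1 + z‖ ^ 2))) 0 1 ∧
      CircleIntegrable (fun z => log (bigRoot (bigRoot l (‖1 + z‖ ^ 2) + 2) 1)) 0 1 := by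
  have hz : ∀ θ : ℝ, ‖circleMap 0 1 θ‖ = 1 := fun θ => by simp
  rw [abs_of_pos (by linarith)]
  constructor
  · refine intervalIntegrable_of_bounds (by fun_prop) fun θ =>
      log_bigRoot_bounds hl (by positivity) le_rfl (by linarith) (sq_norm_one_add_le (hz θ))
  · exact intervalIntegrable_of_bounds (by fun_prop) fun θ =>
      (log_bigRoot_bounds_both hl (by positivity) (sq_norm_one_add_le (hz θ))).2

end LiuQin

theorem mainTheorem1 :
    (∀ l : ℝ, l ≤ -5 →
      LiuQin.HasMahlerMeasure (LiuQin.shiftedQ l) ∧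
      LiuQin.HasMahlerMeasure (LiuQin.R l) ∧
      LiuQin.mahler (LiuQin.shiftedQ l) = LiuQin.mahler (LiuQin.R l)) ∧
    (∀ l : ℝ, 13 ≤ l →
      LiuQin.HasMahlerMeasure (LiuQin.shiftedQ l) ∧
      LiuQin.HasMahlerMeasure (LiuQin.R l) ∧
      LiuQin.HasMahlerMeasure (LiuQin.P l) ∧
      LiuQin.mahler (LiuQin.shiftedQ l) =
        (1 / 2 : ℝ) * (LiuQin.mahler (LiuQin.R l) + LiuQin.mahler (LiuQin.P l))) := by
  refine ⟨fun l hl => ?_, fun l hl => ?_⟩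
  · have hl' : 5 ≤ |l| := by rw [abs_of_nonpos (by linarith)]; linarith
    refine ⟨LiuQin.hasMahlerMeasure_shiftedQ l, LiuQin.hasMahlerMeasure_R hl', ?_⟩
    rw [LiuQin.mahler_shiftedQ (Or.inl hl), LiuQin.mahler_R hl']
    exact LiuQin.circleAverage_congr_unit fun z hz =>
      LiuQin.circleAverage_linkingQuartic_of_le hl hz
  · have hl' : 5 ≤ |l| := by rw [abs_of_nonneg (by linarith)]; linarith
    have hl5 : 5 < l := by linarith
    refine ⟨LiuQin.hasMahlerMeasure_shiftedQ l, LiuQin.hasMahlerMeasure_R hl',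
      LiuQin.hasMahlerMeasure_P hl, ?_⟩
    obtain ⟨i1, i2⟩ := LiuQin.circleIntegrable_log_bigRoot hl5
    rw [LiuQin.mahler_shiftedQ (Or.inr hl), LiuQin.mahler_R hl', LiuQin.mahler_P hl,
      ← LiuQin.circleAverage_log_bigRoot_eq hl5, ← Real.circleAverage_fun_add i1 i2,
      ← smul_eq_mul, ← Real.circleAverage_fun_smul]
    exact LiuQin.circleAverage_congr_unit fun z hz =>
      LiuQin.circleAverage_linkingQuartic_of_ge hl hz
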